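/- For an integer $n\ge 1$ let $\Phi_n$ be the $n$-th cyclotomic polynomial and $\phi$ Euler's totient function, and put $s=-1$ if $n\equiv 3 \pmod 4$, $s=1$ otherwise. Define $$F_n(x)=\begin{cases}\Phi_n(sx), & n \text{ odd},\\ (-1)^{\phi(n/2)}\,\Phi_{n/2}(-x^2), & n\text{ even}.\end{cases}$$ For square-free $n>1$ there are monic polynomials $C_n,D_n$ with integer coefficients (uniquely determined) such that $F_n(x)=C_n(x)^2-nx\,D_n(x)^2$; the Aurifeuillian factors of $F_n(x)$ are, for real $x\ge 0$, $$F_n^{+}(x)=C_n(x)+\sqrt{nx}\,D_n(x),\qquad F_n^{-}(x)=C_n(x)-\sqrt{nx}\,D_n(x).$$ Fix a rational number $m>0$ and let $x=m^2n$. Then, as $n\to\infty$ through square-free integers $n>1$, $$\frac{F_n^{+}(x)}{F_n^{-}(x)}=\exp(2/m)+O(1/n),$$ where the implied constant may depend on $m$. -/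

import Mathlib

open Filter Asymptotics Polynomial

namespace Aurifeuille

/-- The sign `s` attached to `n`: it is `-1` if `n` is congruent to `3` modulo `4`, else `1`. -/
def sgn (n : ℕ) : ℤ := if n % 4 = 3 then -1 else 1

/-- The modified cyclotomic polynomial `F_n`: it is `Φ_n (s x)` if `n` is odd and
`(-1) ^ φ(n / 2) * Φ_{n/2} (-x ^ 2)` if `n` is even. -/
noncomputable def modCyclotomic (n : ℕ) : ℤ[X] :=
  if Odd n then (cyclotomic n ℤ).comp (C (sgn n) * X)
  else C ((-1) ^ Nat.totient (n / 2)) * (cyclotomic (n / 2) ℤ).comp (-X ^ 2)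

/-- `(P, Q)` is a pair of monic integer polynomials with `F_n = P ^ 2 - n x Q ^ 2`. -/
def IsLucasPair (n : ℕ) (P Q : ℤ[X]) : Prop :=
  P.Monic ∧ Q.Monic ∧ modCyclotomic n = P ^ 2 - (n : ℤ[X]) * X * Q ^ 2

open Classical in
/-- The pair `(C_n, D_n)` of monic integer polynomials with `F_n = C_n ^ 2 - n x D_n ^ 2`. For every
square-free `n > 1` there is exactly one such pair. Where there is none the value is `(0, 0)`. -/
noncomputable def lucasPair (n : ℕ) : ℤ[X] × ℤ[X] :=
  if h : ∃ p : ℤ[X] × ℤ[X], IsLucasPair n p.1 p.2 then h.choose else (0, 0)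

/-- The polynomial `C_n`. -/
noncomputable def lucasC (n : ℕ) : ℤ[X] := (lucasPair n).1

/-- The polynomial `D_n`. -/
noncomputable def lucasD (n : ℕ) : ℤ[X] := (lucasPair n).2

/-- The Aurifeuillian factor `C_n(x) + √(n x) D_n(x)`, for real `x ≥ 0`. -/
noncomputable def factorPlus (n : ℕ) (x : ℝ) : ℝ :=
  aeval x (lucasC n) + √((n : ℝ) * x) * aeval x (lucasD n)

/-- The Aurifeuillian factor `C_n(x) - √(n x) D_n(x)`, for real `x ≥ 0`. -/
noncomputable def factorMinus (n : ℕ) (x : ℝ) : ℝ :=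
  aeval x (lucasC n) - √((n : ℝ) * x) * aeval x (lucasD n)

end Aurifeuille

/-! For square-free `n > 1`, `F_n` is `Φ_n` or `Φ_{2n}`. Choose one square root `r i` of each of its
roots so that the odd power sums are `∑ r i ^ k = a k * √n` with `|a k| ≤ 1` and `a 1 = 1`. The
choice is made with the real primitive character `f` of conductor `n` or `4 * n` with `f (-1) = 1`,
and the power sums are Gauss sums (`exists_isLucasRoots`).

Let `L(w) = ∏ (w - r i)`. Newton's identities put the `k`-th elementary symmetric function of the `r
i` in `ℚ * √n ^ k`; integrality and square-freeness then give `L(w) = P(w²) - √n w Q(w²)` with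
integer `P`, `Q` (`exists_lucasPair`). As `L(w) L(-w) = F_n(w²)` and the pair is unique
(`IsLucasPair.unique`), `P = C_n` and `Q = D_n`.

With `z = m√n` the quotient is therefore `∏ (z + r i) / (z - r i)`, the exponential of `∑ (2u +
2u³/3 + O(|u|⁴))` over `u = r i / z`. The linear terms sum to exactly `2/m`, the cubic ones to
`O(1/n)` since `∑ r i ^ 3 = a 3 * √n`, and the at most `2n` remainders, each `O(1/n²)`, to `O(1/n)`.
-/

namespace Aurifeuille

/-! ### Real primitive characters of conductor `n` or `4 * n`. -/

/-- A multiplicative function with values `±1` on units and `0` elsewhere, which is nontrivial on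
the stabilizer of every nonunit (for `ZMod n`: a primitive quadratic Dirichlet character). -/
structure IsRealPrimitive {R : Type*} [CommRing R] (f : R →* ℤ) : Prop where
  map_unit : ∀ u : Rˣ, f u = 1 ∨ f u = -1
  map_nonunit : ∀ k : R, ¬IsUnit k → f k = 0
  exists_stabilizer : ∀ k : R, ¬IsUnit k → ∃ u : Rˣ, (u : R) * k = k ∧ f u = -1

namespace IsRealPrimitive

/-- Primitivity is phrased through stabilizers so that it passes to products: the unit is changed
only in a coordinate where `k` is not a unit. -/
lemma prod {R S : Type*} [CommRing R] [CommRing S] {f : R →* ℤ} {g : S →* ℤ}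
    (hf : IsRealPrimitive f) (hg : IsRealPrimitive g) :
    IsRealPrimitive (f.comp (MonoidHom.fst R S) * g.comp (MonoidHom.snd R S)) where
  map_unit u := by
    have h1 := hf.map_unit (Units.map (MonoidHom.fst R S) u)
    have h2 := hg.map_unit (Units.map (MonoidHom.snd R S) u)
    simp only [Units.coe_map, MonoidHom.coe_fst, MonoidHom.coe_snd] at h1 h2
    rcases h1 with h1 | h1 <;> rcases h2 with h2 | h2 <;> simp [h1, h2]
  map_nonunit k hk := by
    rw [Prod.isUnit_iff, not_and_or] at hk
    rcases hk with hk | hk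
    · simp [hf.map_nonunit _ hk]
    · simp [hg.map_nonunit _ hk]
  exists_stabilizer k hk := by
    rw [Prod.isUnit_iff, not_and_or] at hk
    rcases hk with hk | hk
    · obtain ⟨u, hu, hfu⟩ := hf.exists_stabilizer _ hk
      exact ⟨⟨(u, 1), (↑u⁻¹, 1), by simp, by simp⟩, by ext <;> simp [hu], by simp [hfu]⟩
    · obtain ⟨u, hu, hgu⟩ := hg.exists_stabilizer _ hk
      exact ⟨⟨(1, u), (1, ↑u⁻¹), by simp, by simp⟩, by ext <;> simp [hu], by simp [hgu]⟩

lemma comp_ringEquiv {R S : Type*} [CommRing R] [CommRing S] {f : R →* ℤ}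
    (hf : IsRealPrimitive f) (e : S ≃+* R) :
    IsRealPrimitive (f.comp (e : S →* R)) where
  map_unit u := by simpa using hf.map_unit (Units.map (e : S →* R) u)
  map_nonunit k hk := by
    simpa using hf.map_nonunit (e k) (by simpa using hk)
  exists_stabilizer k hk := by
    obtain ⟨u, hu, hfu⟩ := hf.exists_stabilizer (e k) (by simpa using hk)
    refine ⟨Units.map (e.symm : R →* S) u, e.injective ?_, by simpa using hfu⟩
    simpa using hu

lemma exists_zmod_mul {a b : ℕ} (hab : a.Coprime b) {f : ZMod a →* ℤ} {g : ZMod b →* ℤ}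
    (hf : IsRealPrimitive f) (hg : IsRealPrimitive g) :
    ∃ h : ZMod (a * b) →* ℤ, IsRealPrimitive h ∧ h (-1) = f (-1) * g (-1) :=
  ⟨_, (hf.prod hg).comp_ringEquiv (ZMod.chineseRemainder hab), by simp⟩

end IsRealPrimitive

lemma isRealPrimitive_quadraticChar (p : ℕ) [Fact p.Prime] (hp : p ≠ 2) :
    IsRealPrimitive (quadraticChar (ZMod p) : ZMod p →* ℤ) where
  map_unit u := by simpa using quadraticChar_dichotomy u.ne_zero
  map_nonunit k hk := (quadraticChar (ZMod p)).map_nonunit hk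
  exists_stabilizer k hk := by
    obtain ⟨u, hu⟩ := quadraticChar_exists_neg_one' (F := ZMod p) (by rwa [ZMod.ringChar_zmod_n])
    have hk : k = 0 := by simpa using hk
    exact ⟨u, by simp [hk], by simpa using hu⟩

lemma isRealPrimitive_χ₄ : IsRealPrimitive (ZMod.χ₄ : ZMod 4 →* ℤ) :=
  ⟨by decide, by decide, by decide⟩

lemma isRealPrimitive_χ₈ : IsRealPrimitive (ZMod.χ₈ : ZMod 8 →* ℤ) :=
  ⟨by decide, by decide, by decide⟩

lemma isRealPrimitive_χ₈' : IsRealPrimitive (ZMod.χ₈' : ZMod 8 →* ℤ) :=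
  ⟨by decide, by decide, by decide⟩

/-- The Jacobi symbol modulo `n`, built one prime at a time; each Legendre symbol takes the value
`χ₄ p` at `-1`. -/
lemma exists_isRealPrimitive_of_odd {n : ℕ} (hn : Odd n) (hsq : Squarefree n) :
    ∃ f : ZMod n →* ℤ, IsRealPrimitive f ∧ f (-1) = ZMod.χ₄ n := by
  induction n using Nat.strong_induction_on with
  | _ n ih =>
    by_cases h1 : n = 1
    · subst h1
      refine ⟨1, ⟨by simp, fun k hk => (hk (by rw [Subsingleton.elim k 1]; exact isUnit_one)).elim,
        fun k hk => (hk (by rw [Subsingleton.elim k 1]; exact isUnit_one)).elim⟩, by simp⟩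
    · have hp := Nat.minFac_prime h1
      obtain ⟨k, hk⟩ := n.minFac_dvd
      set p := n.minFac
      have : Fact p.Prime := ⟨hp⟩
      rw [hk] at hn hsq
      obtain ⟨hpo, hko⟩ := Nat.odd_mul.1 hn
      have hcop := Nat.coprime_of_squarefree_mul hsq
      have hp2 : p ≠ 2 := by rintro h; rw [h] at hpo; exact absurd hpo (by decide)
      have hkn : k < n := by
        rw [hk]; exact (Nat.lt_mul_iff_one_lt_left hko.pos).2 hp.one_lt
      obtain ⟨g, hg, hg1⟩ := ih k hkn hko hsq.of_mul_right
      obtain ⟨h, hh, h1⟩ := (isRealPrimitive_quadraticChar p hp2).exists_zmod_mul hcop hg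
      rw [hk]
      refine ⟨h, hh, ?_⟩
      rw [h1, hg1]
      have := quadraticChar_neg_one (F := ZMod p) (by rwa [ZMod.ringChar_zmod_n])
      rw [ZMod.card] at this
      rw [Nat.cast_mul, map_mul, ← this]
      rfl

lemma exists_isRealPrimitive_of_one_mod_four {n : ℕ} (hn : n % 4 = 1) (hsq : Squarefree n) :
    ∃ f : ZMod n →* ℤ, IsRealPrimitive f ∧ f (-1) = 1 := by
  obtain ⟨f, hf, h⟩ := exists_isRealPrimitive_of_odd (Nat.odd_iff.2 (by omega)) hsq
  exact ⟨f, hf, by rw [h, ZMod.χ₄_nat_one_mod_four hn]⟩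

/-- The factor at 2 (`χ₄`, `χ₈` or `χ₈'`) is chosen so that its value at `-1` cancels that of the
Jacobi symbol of the odd part. -/
lemma exists_isRealPrimitive_four_mul {n : ℕ} (hn : n % 4 ≠ 1) (hsq : Squarefree n) :
    ∃ f : ZMod (4 * n) →* ℤ, IsRealPrimitive f ∧ f (-1) = 1 := by
  rcases Nat.even_or_odd n with he | ho
  · obtain ⟨k, rfl⟩ := he.two_dvd
    have hcop := Nat.coprime_of_squarefree_mul hsq
    have hk : Odd k := Nat.coprime_two_left.1 hcop
    obtain ⟨g, hg, hg1⟩ := exists_isRealPrimitive_of_odd hk hsq.of_mul_right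
    have h8 : Nat.Coprime 8 k := Nat.Coprime.pow_left 3 hcop
    rw [show 4 * (2 * k) = 8 * k by ring]
    rcases Nat.odd_mod_four_iff.1 (Nat.odd_iff.1 hk) with h | h
    · obtain ⟨f, hf, h1⟩ := isRealPrimitive_χ₈.exists_zmod_mul h8 hg
      refine ⟨f, hf, ?_⟩
      rw [h1, hg1, ZMod.χ₄_nat_one_mod_four h]; decide
    · obtain ⟨f, hf, h1⟩ := isRealPrimitive_χ₈'.exists_zmod_mul h8 hg
      refine ⟨f, hf, ?_⟩
      rw [h1, hg1, ZMod.χ₄_nat_three_mod_four h]; decide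
  · obtain ⟨g, hg, hg1⟩ := exists_isRealPrimitive_of_odd ho hsq
    have h4 : Nat.Coprime 4 n := Nat.Coprime.pow_left 2 (Nat.coprime_two_left.2 ho)
    obtain ⟨f, hf, h1⟩ := isRealPrimitive_χ₄.exists_zmod_mul h4 hg
    refine ⟨f, hf, ?_⟩
    have := Nat.odd_iff.1 ho
    rw [h1, hg1, ZMod.χ₄_nat_three_mod_four (by omega)]; decide

/-! ### Gauss sums of real primitive characters. -/

namespace IsRealPrimitive

variable {R : Type*} [CommRing R] [Fintype R] {f : R →* ℤ}

lemma map_pow_of_odd (hf : IsRealPrimitive f) (j : R) {k : ℕ} (hk : Odd k) : f j ^ k = f j := by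
  by_cases hj : IsUnit j
  · obtain ⟨u, rfl⟩ := hj
    rcases hf.map_unit u with h | h <;> simp [h, hk.neg_one_pow]
  · simp [hf.map_nonunit j hj, hk.pos.ne']

lemma abs_le_one (hf : IsRealPrimitive f) (j : R) : |f j| ≤ 1 := by
  by_cases hj : IsUnit j
  · obtain ⟨u, rfl⟩ := hj
    rcases hf.map_unit u with h | h <;> simp [h]
  · simp [hf.map_nonunit j hj]

/-- For a unit `k`, substitute `j * k` for `j`. For a nonunit, a unit fixing `k` with `f = -1` shows
that the sum is its own negative. -/
lemma sum_mul_addChar (hf : IsRealPrimitive f) (ψ : AddChar R ℂ) (k : R) :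
    ∑ j, (f j : ℂ) * ψ (j * k) = f k * ∑ j, (f j : ℂ) * ψ j := by
  by_cases hk : IsUnit k
  · obtain ⟨u, rfl⟩ := hk
    have h1 : (f u : ℂ) * f u = 1 := by
      rcases hf.map_unit u with h | h <;> simp [h]
    rw [Finset.mul_sum, ← Equiv.sum_comp (Units.mulRight u) (fun j => (f u : ℂ) * (f j * ψ j))]
    refine Finset.sum_congr rfl fun j _ => ?_
    simp only [Units.mulRight_apply, map_mul, Int.cast_mul]
    linear_combination (-(f j : ℂ) * ψ (j * u)) * h1
  · obtain ⟨u, hu, hfu⟩ := hf.exists_stabilizer k hk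
    rw [hf.map_nonunit k hk, Int.cast_zero, zero_mul]
    have : ∑ j, (f j : ℂ) * ψ (j * k) = -∑ j, (f j : ℂ) * ψ (j * k) := by
      conv_lhs => rw [← Equiv.sum_comp (Units.mulRight u)]
      rw [← Finset.sum_neg_distrib]
      refine Finset.sum_congr rfl fun j _ => ?_
      simp [hfu, mul_assoc, hu]
    linear_combination this / 2

/-- Evaluate `∑ k, G(k) G(-k)` twice, where `G(k) = ∑ j, f j * ψ (j * k)`: by `G(k) = f k * G(1)`,
and by orthogonality of additive characters. -/
lemma sq_sum_mul_addChar [Nontrivial R] (hf : IsRealPrimitive f) (h1 : f (-1) = 1)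
    {ψ : AddChar R ℂ} (hψ : ψ.IsPrimitive) :
    (∑ j, (f j : ℂ) * ψ j) ^ 2 = Fintype.card R := by
  classical
  set θ := ∑ j, (f j : ℂ) * ψ j with hθ
  set S : ℂ := ∑ k, (f k : ℂ) ^ 2 with hS
  have hS0 : S ≠ 0 := by
    have : S = ((∑ k, f k ^ 2 : ℤ) : ℂ) := by push_cast; rfl
    rw [this, Int.cast_ne_zero]
    refine (Finset.sum_pos' (fun i _ => sq_nonneg _) ⟨1, Finset.mem_univ _, by simp⟩).ne'
  have e1 : ∑ k, (∑ i, (f i : ℂ) * ψ (i * k)) * (∑ j, (f j : ℂ) * ψ (j * -k)) = θ ^ 2 * S := by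
    rw [hS, Finset.mul_sum]
    refine Finset.sum_congr rfl fun k _ => ?_
    rw [hf.sum_mul_addChar, hf.sum_mul_addChar, ← neg_one_mul k, map_mul, h1]
    push_cast; ring
  have e2 : ∑ k, (∑ i, (f i : ℂ) * ψ (i * k)) * (∑ j, (f j : ℂ) * ψ (j * -k))
      = Fintype.card R * S := by
    simp_rw [Finset.sum_mul_sum]
    rw [Finset.sum_comm]
    rw [hS, Finset.mul_sum]
    refine Finset.sum_congr rfl fun i _ => ?_
    rw [Finset.sum_comm]
    have : ∀ j, ∑ k, (f i : ℂ) * ψ (i * k) * (f j * ψ (j * -k))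
        = f i * f j * if i - j = 0 then (Fintype.card R : ℂ) else 0 := by
      intro j
      have := AddChar.sum_mulShift (i - j) hψ
      rw [Nat.cast_ite, Nat.cast_zero] at this
      rw [← this, Finset.mul_sum]
      refine Finset.sum_congr rfl fun k _ => ?_
      rw [show k * (i - j) = i * k + j * -k by ring, AddChar.map_add_eq_mul]
      ring
    simp_rw [this, sub_eq_zero]
    simp
    ring
  exact mul_right_cancel₀ hS0 (e1.symm.trans e2)

end IsRealPrimitive

/-! ### Cyclotomic polynomials, and `F_n` as one of them. -/

lemma stdAddChar_unit_isPrimitiveRoot {M : ℕ} [NeZero M] (u : (ZMod M)ˣ) :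
    IsPrimitiveRoot (ZMod.stdAddChar (u : ZMod M)) M := by
  rw [Complex.isPrimitiveRoot_iff _ _ (NeZero.ne M)]
  refine ⟨(u : ZMod M).val, ZMod.val_lt _, ZMod.val_coe_unit_coprime u, ?_⟩
  have := ZMod.stdAddChar_coe (N := M) ((u : ZMod M).val : ℤ)
  rw [Int.cast_natCast, ZMod.natCast_zmod_val] at this
  rw [this]
  push_cast
  congr 1; ring

lemma prod_units_X_sub_C_stdAddChar (M : ℕ) [NeZero M] :
    ∏ u : (ZMod M)ˣ, (X - C (ZMod.stdAddChar (u : ZMod M))) = cyclotomic M ℂ := by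
  rw [cyclotomic_eq_prod_X_sub_primitiveRoots (Complex.isPrimitiveRoot_exp M (NeZero.ne M))]
  refine Finset.prod_bij (fun u _ => ZMod.stdAddChar (u : ZMod M)) (fun u _ => ?_)
    (fun u _ v _ h => Units.ext (ZMod.injective_stdAddChar h)) (fun μ hμ => ?_) fun _ _ => rfl
  · exact (mem_primitiveRoots (NeZero.pos M)).2 (stdAddChar_unit_isPrimitiveRoot u)
  · rw [mem_primitiveRoots (NeZero.pos M), Complex.isPrimitiveRoot_iff _ _ (NeZero.ne M)] at hμ
    obtain ⟨i, -, hi, rfl⟩ := hμ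
    refine ⟨ZMod.unitOfCoprime i hi, Finset.mem_univ _, ?_⟩
    have := ZMod.stdAddChar_coe (N := M) (i : ℤ)
    rw [Int.cast_natCast] at this
    rw [ZMod.coe_unitOfCoprime, this]
    push_cast
    congr 1; ring

lemma eval_cyclotomic_eq_prod_units (M : ℕ) [NeZero M] (w : ℂ) :
    (cyclotomic M ℂ).eval w = ∏ u : (ZMod M)ˣ, (w - ZMod.stdAddChar (u : ZMod M)) := by
  rw [← prod_units_X_sub_C_stdAddChar, eval_prod]
  simp

lemma eval_sq_cyclotomic_of_odd {n : ℕ} [NeZero n] (hn : Odd n) (w : ℂ) :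
    (cyclotomic n ℂ).eval (w ^ 2)
      = ∏ u : (ZMod n)ˣ, (w ^ 2 - ZMod.stdAddChar (u : ZMod n) ^ 2) := by
  rw [eval_cyclotomic_eq_prod_units,
    ← Equiv.prod_comp (Equiv.mulLeft (ZMod.unitOfCoprime 2 (Nat.coprime_two_left.2 hn)))]
  refine Finset.prod_congr rfl fun u _ => ?_
  rw [← AddChar.map_nsmul_eq_pow]
  simp

/-- Squaring permutes the primitive `n`-th roots `ζ`, so `Φ_n(w²) = ∏ (w - ζ)(w + ζ)`; compare with
`Φ_n(w²) = Φ_n(w) Φ_{2n}(w)` and cancel `Φ_n`. -/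
lemma cyclotomic_comp_neg_X_of_odd {n : ℕ} (hn : Odd n) :
    (cyclotomic n ℤ).comp (-X) = C ((-1) ^ n.totient) * cyclotomic (2 * n) ℤ := by
  have : NeZero n := ⟨hn.pos.ne'⟩
  have h2 : ¬ 2 ∣ n := by rw [← even_iff_two_dvd]; exact Nat.not_even_iff_odd.2 hn
  have key : cyclotomic n ℂ * (cyclotomic n ℂ).comp (-X)
      = cyclotomic n ℂ * (C ((-1) ^ n.totient) * cyclotomic (2 * n) ℂ) := by
    have hexp := cyclotomic_expand_eq_cyclotomic_mul Nat.prime_two h2 ℂ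
    refine Polynomial.funext fun w => ?_
    have h := congrArg (eval w) hexp
    rw [expand_eval, eval_sq_cyclotomic_of_odd hn, eval_mul, mul_comm n 2] at h
    simp only [eval_mul, eval_comp, eval_neg, eval_X, eval_C]
    rw [mul_left_comm, mul_comm (eval w (cyclotomic n ℂ)) (eval w _), ← h,
      eval_cyclotomic_eq_prod_units, eval_cyclotomic_eq_prod_units, ← ZMod.card_units_eq_totient,
      ← Finset.card_univ, ← Finset.prod_const, ← Finset.prod_mul_distrib,
      ← Finset.prod_mul_distrib]
    exact Finset.prod_congr rfl fun u _ => by ring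
  have key := mul_left_cancel₀ (cyclotomic_ne_zero n ℂ) key
  apply map_injective (Int.castRingHom ℂ) Int.cast_injective
  simpa [Polynomial.map_comp] using key

lemma modCyclotomic_of_one_mod_four {n : ℕ} (hn : n % 4 = 1) :
    modCyclotomic n = cyclotomic n ℤ := by
  have ho : Odd n := Nat.odd_iff.2 (by omega)
  simp [modCyclotomic, ho, sgn, hn]

lemma modCyclotomic_of_not_one_mod_four {n : ℕ} (hn : n % 4 ≠ 1) (h1 : 1 < n)
    (hsq : Squarefree n) : modCyclotomic n = cyclotomic (2 * n) ℤ := by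
  rcases Nat.even_or_odd n with he | ho
  · obtain ⟨k, rfl⟩ := he.two_dvd
    have hk : Odd k := Nat.coprime_two_left.1 (Nat.coprime_of_squarefree_mul hsq)
    have hno : ¬ Odd (2 * k) := Nat.not_odd_iff_even.2 he
    have hcomp : (cyclotomic k ℤ).comp (-X ^ 2) = ((cyclotomic k ℤ).comp (-X)).comp (X ^ 2) := by
      rw [comp_assoc]; simp
    rw [modCyclotomic, if_neg hno, Nat.mul_div_cancel_left k two_pos, hcomp,
      cyclotomic_comp_neg_X_of_odd hk, mul_comp, C_comp, ← mul_assoc, ← C_mul, ← mul_pow,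
      ← expand_eq_comp_X_pow,
      cyclotomic_expand_eq_cyclotomic Nat.prime_two (Nat.dvd_mul_right 2 k), mul_comm (2 * k) 2]
    simp
  · have := Nat.odd_iff.1 ho
    have h3 : n % 4 = 3 := by omega
    have hX : C (sgn n) * X = (-X : ℤ[X]) := by simp [sgn, h3]
    rw [modCyclotomic, if_pos ho, hX, cyclotomic_comp_neg_X_of_odd ho,
      (Nat.totient_even (by omega)).neg_one_pow]
    simp

lemma exists_modCyclotomic_eq {n : ℕ} (h1 : 1 < n) (hsq : Squarefree n) :
    ∃ k, 2 < k ∧ k ≤ 2 * n ∧ modCyclotomic n = cyclotomic k ℤ := by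
  by_cases hn : n % 4 = 1
  · exact ⟨n, by omega, by omega, modCyclotomic_of_one_mod_four hn⟩
  · exact ⟨2 * n, by omega, le_rfl, modCyclotomic_of_not_one_mod_four hn h1 hsq⟩

/-! ### Square roots of the roots of `F_n` with prescribed odd power sums. -/

/-- `r` lists one square root of each root of `F_n`, chosen so that the odd power sums are
`a k * √n`. -/
structure IsLucasRoots (n : ℕ) {ι : Type*} [Fintype ι] (r : ι → ℂ) (a : ℕ → ℤ) : Prop where
  pow_eq_one : ∀ i, r i ^ (4 * n) = 1
  eval_sq : ∀ w : ℂ, aeval (w ^ 2) (modCyclotomic n) = ∏ i, (w ^ 2 - r i ^ 2)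
  abs_le_one : ∀ k, |a k| ≤ 1
  one : a 1 = 1
  sum_pow : ∀ k, Odd k → ∑ i, r i ^ k = a k * (√n : ℝ)

/-- The sign of the Gauss sum is never needed: if `θ = -√n`, replace `r` by `-r`. -/
lemma IsLucasRoots.exists_of_sq_eq {n : ℕ} {ι : Type*} [Fintype ι] {r : ι → ℂ} {a : ℕ → ℤ} {θ : ℂ}
    (hr : ∀ i, r i ^ (4 * n) = 1)
    (hF : ∀ w : ℂ, aeval (w ^ 2) (modCyclotomic n) = ∏ i, (w ^ 2 - r i ^ 2))
    (ha : ∀ k, |a k| ≤ 1) (ha1 : a 1 = 1) (hs : ∀ k, Odd k → ∑ i, r i ^ k = a k * θ)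
    (hθ : θ ^ 2 = n) : ∃ r : ι → ℂ, IsLucasRoots n r a := by
  have h : θ ^ 2 = ((√n : ℝ) : ℂ) ^ 2 := by
    rw [hθ, ← Complex.ofReal_pow, Real.sq_sqrt (Nat.cast_nonneg n)]; simp
  rcases sq_eq_sq_iff_eq_or_eq_neg.1 h with rfl | rfl
  · exact ⟨r, hr, hF, ha, ha1, hs⟩
  · refine ⟨fun i => -r i, fun i => ?_, by simpa using hF, ha, ha1, fun k hk => ?_⟩
    · rw [Even.neg_pow ⟨2 * n, by ring⟩, hr]
    · simp [hk.neg_pow, hs k hk]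

lemma aeval_modCyclotomic {n k : ℕ} (h : modCyclotomic n = cyclotomic k ℤ) (w : ℂ) :
    aeval w (modCyclotomic n) = (cyclotomic k ℂ).eval w := by
  rw [h, aeval_def, eval₂_eq_eval_map, algebraMap_int_eq, map_cyclotomic_int]

lemma sum_units_eq_sum {R : Type*} [CommRing R] [Fintype R] [DecidableEq R] (g : R → ℂ)
    (hg : ∀ k, ¬IsUnit k → g k = 0) : ∑ u : Rˣ, g u = ∑ j, g j := by
  refine Finset.sum_of_injOn (fun u : Rˣ => (u : R)) (fun a _ b _ h => Units.ext h)
    (fun _ _ => Finset.mem_coe.2 (Finset.mem_univ _))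
    (fun j _ hj => hg j fun ⟨u, hu⟩ => hj ⟨u, by simp, hu⟩)
    fun _ _ => rfl

lemma exists_isLucasRoots_of_one_mod_four {n : ℕ} (hn : n % 4 = 1) (h1 : 1 < n)
    (hsq : Squarefree n) :
    ∃ (r : (ZMod n)ˣ → ℂ) (a : ℕ → ℤ) (_ : NeZero n), IsLucasRoots n r a := by
  have : NeZero n := ⟨by omega⟩
  have : Fact (1 < n) := ⟨h1⟩
  obtain ⟨f, hf, hf1⟩ := exists_isRealPrimitive_of_one_mod_four hn hsq
  set ψ := ZMod.stdAddChar (N := n)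
  have hsqf : ∀ u : (ZMod n)ˣ, (f u : ℂ) ^ 2 = 1 := fun u => by
    rcases hf.map_unit u with h | h <;> simp [h]
  have hθ := hf.sq_sum_mul_addChar hf1 (ZMod.isPrimitive_stdAddChar n)
  rw [ZMod.card] at hθ
  suffices h : ∃ r : (ZMod n)ˣ → ℂ, IsLucasRoots n r fun k => f k from
    h.elim fun r hr => ⟨r, _, ‹_›, hr⟩
  -- The roots are `f u * ζ ^ u`; for odd `k`, `f u ^ k = f u`, so the `k`-th power sum is a twisted
  -- Gauss sum.
  refine IsLucasRoots.exists_of_sq_eq (r := fun u : (ZMod n)ˣ => (f u : ℂ) * ψ u)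
    (a := fun k => f k) (fun u => ?_) (fun w => ?_) (fun k => hf.abs_le_one _) (by simp)
    (fun k hk => ?_) hθ
  · rw [mul_pow, show 4 * n = 2 * (n * 2) by ring, pow_mul, hsqf, one_pow, one_mul, mul_left_comm,
      pow_mul, (stdAddChar_unit_isPrimitiveRoot u).pow_eq_one, one_pow]
  · rw [aeval_modCyclotomic (modCyclotomic_of_one_mod_four hn),
      eval_sq_cyclotomic_of_odd (Nat.odd_iff.2 (by omega))]
    exact Finset.prod_congr rfl fun u _ => by rw [mul_pow, hsqf, one_mul]
  · rw [← hf.sum_mul_addChar, ← sum_units_eq_sum (fun j => (f j : ℂ) * ψ (j * k))]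
    · refine Finset.sum_congr rfl fun u _ => ?_
      rw [mul_pow, ← Int.cast_pow, hf.map_pow_of_odd _ hk, ← AddChar.map_nsmul_eq_pow,
        nsmul_eq_mul, mul_comm (k : ZMod n)]
    · intro j hj
      simp [hf.map_nonunit j hj]

/-- The units split into `f = 1` and `f = -1`, and a unit `v` with `f v = -1` swaps the parts. -/
lemma prod_units_eq_prod_subtype {R M : Type*} [CommRing R] [Fintype R] [DecidableEq R]
    [CommMonoid M] {f : R →* ℤ} (hf : IsRealPrimitive f) {v : Rˣ} (hv : f v = -1) (g : Rˣ → M) :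
    ∏ u, g u = ∏ u : {u : Rˣ // f u = 1}, (g u * g (u * v)) := by
  rw [← Fintype.prod_subtype_mul_prod_subtype (fun u : Rˣ => f u = 1), Finset.prod_mul_distrib]
  congr 1
  refine (Fintype.prod_equiv ((Equiv.mulRight v).subtypeEquiv fun u => ?_) _ _ fun u => rfl).symm
  rcases hf.map_unit u with h | h <;> simp [h, hv]

lemma exists_isLucasRoots_of_not_one_mod_four {n : ℕ} (hn : n % 4 ≠ 1) (h1 : 1 < n)
    (hsq : Squarefree n) : ∃ (f : ZMod (4 * n) →* ℤ) (_ : NeZero (4 * n))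
      (r : {u : (ZMod (4 * n))ˣ // f u = 1} → ℂ) (a : ℕ → ℤ), IsLucasRoots n r a := by
  have : NeZero (4 * n) := ⟨by omega⟩
  have : Fact (1 < 4 * n) := ⟨by omega⟩
  obtain ⟨f, hf, hf1⟩ := exists_isRealPrimitive_four_mul hn hsq
  refine ⟨f, ‹_›, ?_⟩
  set ψ := ZMod.stdAddChar (N := 4 * n)
  -- From `2 * v = 2` and `v ≠ 1`, multiplication by `v` negates `ψ`. Hence `f = 1` selects one root
  -- from each pair `±ψ u`, and odd power sums are half Gauss sums, with `(θ / 2) ^ 2 = 4n / 4 = n`.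
  obtain ⟨v, hv2, hv⟩ := hf.exists_stabilizer (2 : ZMod (4 * n)) (by
    have := (ZMod.isUnit_iff_coprime 2 (4 * n)).not.2 (by
      rw [Nat.coprime_two_left]; exact Nat.not_odd_iff_even.2 ⟨2 * n, by ring⟩)
    simpa using this)
  have hψv : ∀ u : (ZMod (4 * n))ˣ, ψ (u * v : (ZMod (4 * n))ˣ) = -ψ u := by
    intro u
    have h : ψ (u * v : (ZMod (4 * n))ˣ) ^ 2 = ψ u ^ 2 := by
      rw [← AddChar.map_nsmul_eq_pow, ← AddChar.map_nsmul_eq_pow]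
      congr 1
      simp only [Units.val_mul, nsmul_eq_mul, Nat.cast_ofNat]
      linear_combination (u : ZMod (4 * n)) * hv2
    refine (sq_eq_sq_iff_eq_or_eq_neg.1 h).resolve_left fun h => ?_
    have h := mul_eq_left.1 (Units.ext (ZMod.injective_stdAddChar h))
    rw [h] at hv
    simp at hv
  have hθ := hf.sq_sum_mul_addChar hf1 (ZMod.isPrimitive_stdAddChar (4 * n))
  rw [ZMod.card] at hθ
  have hodd : ∀ k : ℕ, Odd k → ∑ u : {u : (ZMod (4 * n))ˣ // f u = 1}, ψ (u : (ZMod (4 * n))ˣ) ^ k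
      = f k * ((∑ j, (f j : ℂ) * ψ j) / 2) := by
    intro k hk
    rw [← mul_div_assoc, ← hf.sum_mul_addChar,
      ← sum_units_eq_sum (fun j => (f j : ℂ) * ψ (j * k))]
    -- `Multiplicative ℂ` turns the splitting of products into one of sums.
    · have := prod_units_eq_prod_subtype (M := Multiplicative ℂ) hf hv
        (fun u => Multiplicative.ofAdd ((f u : ℂ) * ψ (u * k)))
      have := congrArg Multiplicative.toAdd this
      simp only [toAdd_prod, toAdd_mul, toAdd_ofAdd] at this
      rw [this, Finset.sum_div]
      refine Finset.sum_congr rfl fun u _ => ?_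
      have e : ∀ x : (ZMod (4 * n)), ψ (x * k) = ψ x ^ k := fun x => by
        rw [← AddChar.map_nsmul_eq_pow, nsmul_eq_mul, mul_comm x]
      rw [e, e, hψv, hk.neg_pow]
      simp [hv, u.2]
    · intro j hj
      simp [hf.map_nonunit j hj]
  suffices h : ∃ r : {u : (ZMod (4 * n))ˣ // f u = 1} → ℂ, IsLucasRoots n r fun k => f k from
    h.elim fun r hr => ⟨r, _, hr⟩
  refine IsLucasRoots.exists_of_sq_eq
    (r := fun u : {u : (ZMod (4 * n))ˣ // f u = 1} => ψ (u : (ZMod (4 * n))ˣ))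
    (a := fun k => f k) (fun u => (stdAddChar_unit_isPrimitiveRoot _).pow_eq_one) (fun w => ?_)
    (fun k => hf.abs_le_one _) (by simp) hodd (by rw [div_pow, hθ]; push_cast; ring_nf)
  · rw [aeval_modCyclotomic (modCyclotomic_of_not_one_mod_four hn h1 hsq), ← expand_eval,
      cyclotomic_expand_eq_cyclotomic Nat.prime_two (Nat.dvd_mul_right 2 n),
      show 2 * n * 2 = 4 * n by ring, eval_cyclotomic_eq_prod_units,
      prod_units_eq_prod_subtype hf hv]
    refine Finset.prod_congr rfl fun u _ => ?_
    rw [hψv]; ring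

theorem exists_isLucasRoots {n : ℕ} (h1 : 1 < n) (hsq : Squarefree n) :
    ∃ (ι : Type) (_ : Fintype ι) (r : ι → ℂ) (a : ℕ → ℤ), IsLucasRoots n r a := by
  by_cases hn : n % 4 = 1
  · obtain ⟨r, a, _, h⟩ := exists_isLucasRoots_of_one_mod_four hn h1 hsq
    exact ⟨_, _, r, a, h⟩
  · obtain ⟨f, _, r, a, h⟩ := exists_isLucasRoots_of_not_one_mod_four hn h1 hsq
    exact ⟨_, _, r, a, h⟩

/-! ### Newton's identities graded by powers of `s`, and integrality. -/

section Newton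

variable {ι : Type*} [Fintype ι] {s : ℂ} {r : ι → ℂ}

lemma mul_mem_span_pow {i j : ℕ} {x y : ℂ} (hx : x ∈ Submodule.span ℚ {s ^ i})
    (hy : y ∈ Submodule.span ℚ {s ^ j}) : x * y ∈ Submodule.span ℚ {s ^ (i + j)} := by
  obtain ⟨a, rfl⟩ := Submodule.mem_span_singleton.1 hx
  obtain ⟨b, rfl⟩ := Submodule.mem_span_singleton.1 hy
  exact Submodule.mem_span_singleton.2 ⟨a * b, by rw [pow_add, smul_mul_smul_comm]⟩

lemma neg_one_pow_mul_mem {S : Submodule ℚ ℂ} {x : ℂ} (j : ℕ) (hx : x ∈ S) :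
    (-1) ^ j * x ∈ S := by
  rcases neg_one_pow_eq_or ℂ j with h | h <;> simpa [h] using hx

lemma aeval_psum_eq_sum (r : ι → ℂ) (k : ℕ) :
    MvPolynomial.aeval r (MvPolynomial.psum ι ℚ k) = ∑ i, r i ^ k := by
  simp [MvPolynomial.psum]

lemma aeval_esymm_mem_span (h : ∀ k, 0 < k → ∑ i, r i ^ k ∈ Submodule.span ℚ {s ^ k}) (k : ℕ) :
    MvPolynomial.aeval r (MvPolynomial.esymm ι ℚ k) ∈ Submodule.span ℚ {s ^ k} := by
  induction k using Nat.strong_induction_on with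
  | _ k ih =>
    rcases Nat.eq_zero_or_pos k with rfl | hk
    · simp
    · have key := congrArg (MvPolynomial.aeval r) (MvPolynomial.mul_esymm_eq_sum ι ℚ k)
      simp only [map_mul, map_natCast, map_pow, map_neg, map_one, map_sum,
        aeval_psum_eq_sum] at key
      have hmem : (k : ℂ) * MvPolynomial.aeval r (MvPolynomial.esymm ι ℚ k)
          ∈ Submodule.span ℚ {s ^ k} := by
        rw [key]
        refine neg_one_pow_mul_mem _ (Submodule.sum_mem _ fun a ha => ?_)
        rw [Finset.mem_filter, Finset.HasAntidiagonal.mem_antidiagonal] at ha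
        obtain ⟨hak, hlt⟩ := ha
        rw [mul_assoc]
        refine neg_one_pow_mul_mem _ ?_
        rw [← hak]
        exact mul_mem_span_pow (ih _ hlt) (h _ (by omega))
      have := Submodule.smul_mem _ (k : ℚ)⁻¹ hmem
      rwa [Rat.smul_def, ← mul_assoc, Rat.cast_inv, Rat.cast_natCast,
        inv_mul_cancel₀ (by exact_mod_cast hk.ne'), one_mul] at this

lemma sum_pow_mem_span
    (h : ∀ k, MvPolynomial.aeval r (MvPolynomial.esymm ι ℚ k) ∈ Submodule.span ℚ {s ^ k}) (k : ℕ)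
    (hk : 0 < k) : ∑ i, r i ^ k ∈ Submodule.span ℚ {s ^ k} := by
  induction k using Nat.strong_induction_on with
  | _ k ih =>
    have key := congrArg (MvPolynomial.aeval r) (MvPolynomial.psum_eq_mul_esymm_sub_sum ι ℚ k hk)
    simp only [map_mul, map_natCast, map_pow, map_neg, map_one, map_sum, map_sub,
      aeval_psum_eq_sum] at key
    rw [key]
    refine Submodule.sub_mem _ ?_ (Submodule.sum_mem _ fun a ha => ?_)
    · rw [mul_assoc, ← nsmul_eq_mul]
      exact neg_one_pow_mul_mem _ (Submodule.smul_of_tower_mem _ k (h k))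
    · rw [Finset.mem_filter, Finset.HasAntidiagonal.mem_antidiagonal] at ha
      obtain ⟨hak, hlt⟩ := ha
      rw [mul_assoc]
      refine neg_one_pow_mul_mem _ ?_
      have := ih a.2 (by have := hlt.1; omega) (by have := hlt.2; omega)
      rw [← hak]
      exact mul_mem_span_pow (h _) this

lemma coeff_prod_X_sub_C (r : ι → ℂ) {k : ℕ} (hk : k ≤ Fintype.card ι) :
    (∏ i, (X - C (r i))).coeff k = (-1) ^ (Fintype.card ι - k) *
      MvPolynomial.aeval r (MvPolynomial.esymm ι ℚ (Fintype.card ι - k)) := by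
  have := Multiset.prod_X_sub_C_coeff (Finset.univ.val.map r) (k := k) (by simpa using hk)
  rw [MvPolynomial.aeval_esymm_eq_multiset_esymm]
  simpa using this

lemma isIntegral_coeff_prod_X_sub_C (hr : ∀ i, IsIntegral ℤ (r i)) (k : ℕ) :
    IsIntegral ℤ ((∏ i, (X - C (r i))).coeff k) := by
  let r' : ι → integralClosure ℤ ℂ := fun i => ⟨r i, hr i⟩
  have : ∏ i, (X - C (r i)) = (∏ i, (X - C (r' i))).map (algebraMap (integralClosure ℤ ℂ) ℂ) := by
    rw [Polynomial.map_prod]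
    exact Finset.prod_congr rfl fun i _ => by simp [r']
  rw [this, coeff_map]
  exact ((∏ i, (X - C (r' i))).coeff k).2

end Newton

lemma exists_int_of_isIntegral_ratCast {q : ℚ} (h : IsIntegral ℤ (q : ℂ)) : ∃ z : ℤ, q = z := by
  have h : IsIntegral ℤ (algebraMap ℚ ℂ q) := by simpa using h
  rw [isIntegral_algebraMap_iff (algebraMap ℚ ℂ).injective,
    IsIntegrallyClosed.isIntegral_iff] at h
  obtain ⟨z, hz⟩ := h
  exact ⟨z, by simpa using hz.symm⟩

/-- The square of the denominator of `q` divides `n`, so the denominator is 1. -/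
lemma exists_int_of_sq_mul_squarefree {n : ℕ} (hsq : Squarefree n) {q : ℚ} {z : ℤ}
    (h : q ^ 2 * n = z) : ∃ y : ℤ, q = y := by
  have h1 : q.num ^ 2 * n = z * (q.den : ℤ) ^ 2 := by
    have hd : (q.den : ℚ) ≠ 0 := by exact_mod_cast q.den_ne_zero
    rw [← Rat.num_div_den q, div_pow, div_mul_eq_mul_div, div_eq_iff (by positivity)] at h
    exact_mod_cast h
  have h2 : (q.den : ℤ) ^ 2 ∣ n := by
    have hcop : IsCoprime ((q.den : ℤ) ^ 2) (q.num ^ 2) :=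
      (Int.isCoprime_iff_gcd_eq_one.2 (by simpa [Int.gcd] using q.reduced.symm)).pow
    exact hcop.dvd_of_dvd_mul_left ⟨z, by rw [h1, mul_comm]⟩
  have h3 : q.den * q.den ∣ n := by rw [← sq]; exact_mod_cast h2
  have h4 := Nat.isUnit_iff.1 (hsq _ h3)
  exact ⟨q.num, by conv_lhs => rw [← Rat.num_div_den q, h4]; simp⟩

lemma sum_range_two_mul {M : Type*} [AddCommMonoid M] (g : ℕ → M) (h : ℕ) :
    ∑ k ∈ Finset.range (2 * h), g k
      = ∑ j ∈ Finset.range h, g (2 * j) + ∑ j ∈ Finset.range h, g (2 * j + 1) := by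
  induction h with
  | zero => simp
  | succ h ih =>
    rw [mul_add, Finset.sum_range_succ, Finset.sum_range_succ, ih, Finset.sum_range_succ,
      Finset.sum_range_succ]
    abel

/-! ### Existence of the pair `C_n`, `D_n`. -/

namespace IsLucasRoots

variable {n : ℕ} {ι : Type*} [Fintype ι] {r : ι → ℂ} {a : ℕ → ℤ}

lemma map_modCyclotomic (h : IsLucasRoots n r a) :
    (modCyclotomic n).map (Int.castRingHom ℂ) = ∏ i, (X - C (r i ^ 2)) := by
  refine Polynomial.funext fun x => ?_
  obtain ⟨w, rfl⟩ := IsAlgClosed.exists_pow_nat_eq x two_pos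
  have := h.eval_sq w
  rw [aeval_def, eval₂_eq_eval_map, algebraMap_int_eq] at this
  rw [this, eval_prod]
  simp

lemma exists_card (h : IsLucasRoots n r a) (h1 : 1 < n) (hsq : Squarefree n) :
    ∃ m, Fintype.card ι = 2 * m ∧ 0 < m ∧ m ≤ n := by
  obtain ⟨k, hk2, hkn, hk⟩ := exists_modCyclotomic_eq h1 hsq
  have hd := congrArg natDegree h.map_modCyclotomic
  rw [natDegree_finsetProd_X_sub_C_eq_card, hk, map_cyclotomic, natDegree_cyclotomic,
    Finset.card_univ] at hd
  obtain ⟨m, hm⟩ := (Nat.totient_even hk2).two_dvd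
  have := Nat.totient_pos.2 (by omega : 0 < k)
  have := Nat.totient_le k
  exact ⟨m, by omega, by omega, by omega⟩

/-- `F_n` has integer coefficients, so the elementary symmetric functions of the `r i ^ 2` are
rational, hence so are the power sums. -/
lemma sum_sq_pow_mem (h : IsLucasRoots n r a) (k : ℕ) (hk : 0 < k) :
    ∑ i, (r i ^ 2) ^ k ∈ Submodule.span ℚ {(1 : ℂ) ^ k} := by
  refine sum_pow_mem_span (fun k => ?_) k hk
  rcases le_or_gt k (Fintype.card ι) with hk | hk
  · have hc := coeff_prod_X_sub_C (fun i => r i ^ 2) (Nat.sub_le (Fintype.card ι) k)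
    rw [← h.map_modCyclotomic, coeff_map, Nat.sub_sub_self hk] at hc
    have hc2 := congrArg (fun x => (-1) ^ k * x) hc
    simp only [← mul_assoc, ← mul_pow] at hc2
    norm_num at hc2
    rw [← hc2]
    refine neg_one_pow_mul_mem _ (Submodule.mem_span_singleton.2 ⟨(modCyclotomic n).coeff
      (Fintype.card ι - k), ?_⟩)
    simp [Rat.smul_def]
  · rw [MvPolynomial.esymm, Finset.powersetCard_eq_empty.2 (by simpa using hk)]
    simp

lemma sq_sqrt_eq : ((√n : ℝ) : ℂ) ^ 2 = n := by
  rw [← Complex.ofReal_pow, Real.sq_sqrt (Nat.cast_nonneg n)]; simp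

lemma sum_pow_mem (h : IsLucasRoots n r a) (h1 : 1 < n) (k : ℕ) (hk : 0 < k) :
    ∑ i, r i ^ k ∈ Submodule.span ℚ {((√n : ℝ) : ℂ) ^ k} := by
  have hn0 : (n : ℂ) ≠ 0 := by exact_mod_cast (by omega : n ≠ 0)
  rcases Nat.even_or_odd' k with ⟨j, rfl | rfl⟩
  · obtain ⟨q, hq⟩ := Submodule.mem_span_singleton.1 (h.sum_sq_pow_mem j (by omega))
    simp only [← pow_mul] at hq
    refine Submodule.mem_span_singleton.2 ⟨q * ((n : ℚ) ^ j)⁻¹, ?_⟩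
    rw [← hq, pow_mul, sq_sqrt_eq, Rat.smul_def, Rat.smul_def]
    push_cast
    rw [mul_assoc, inv_mul_cancel₀ (pow_ne_zero _ hn0), one_pow]
  · rw [h.sum_pow _ ⟨j, rfl⟩]
    refine Submodule.mem_span_singleton.2 ⟨a (2 * j + 1) * ((n : ℚ) ^ j)⁻¹, ?_⟩
    rw [pow_succ, pow_mul, sq_sqrt_eq, Rat.smul_def]
    push_cast
    field_simp

lemma isIntegral (h : IsLucasRoots n r a) (h1 : 1 < n) (i : ι) : IsIntegral ℤ (r i) :=
  IsIntegral.of_pow (n := 4 * n) (by omega) (by rw [h.pow_eq_one]; exact isIntegral_one)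

lemma exists_coeff_eq (h : IsLucasRoots n r a) (h1 : 1 < n) {k : ℕ} (hk : k ≤ Fintype.card ι) :
    ∃ q : ℚ, (∏ i, (X - C (r i))).coeff k = q * ((√n : ℝ) : ℂ) ^ (Fintype.card ι - k) := by
  have := neg_one_pow_mul_mem (Fintype.card ι - k)
    (aeval_esymm_mem_span (h.sum_pow_mem h1) (Fintype.card ι - k))
  rw [← coeff_prod_X_sub_C r hk] at this
  obtain ⟨q, hq⟩ := Submodule.mem_span_singleton.1 this
  exact ⟨q, by rw [← hq, Rat.smul_def]⟩

lemma exists_coeff_even (h : IsLucasRoots n r a) (h1 : 1 < n) {m j : ℕ}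
    (hm : Fintype.card ι = 2 * m) (hj : j ≤ m) :
    ∃ c : ℤ, (∏ i, (X - C (r i)) : ℂ[X]).coeff (2 * j) = (c : ℂ) := by
  obtain ⟨q, hq⟩ := h.exists_coeff_eq h1 (k := 2 * j) (by omega)
  have hi := isIntegral_coeff_prod_X_sub_C (h.isIntegral h1) (2 * j)
  have e : (∏ i, (X - C (r i))).coeff (2 * j) = ((q * n ^ (m - j) : ℚ) : ℂ) := by
    rw [hq, hm, ← Nat.mul_sub, pow_mul, sq_sqrt_eq]; push_cast; rfl
  rw [e] at hi
  obtain ⟨z, hz⟩ := exists_int_of_isIntegral_ratCast hi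
  exact ⟨z, by rw [e, hz]; simp⟩

lemma exists_coeff_odd (h : IsLucasRoots n r a) (h1 : 1 < n) (hsq : Squarefree n) {m j : ℕ}
    (hm : Fintype.card ι = 2 * m) (hj : j < m) :
    ∃ d : ℤ, (∏ i, (X - C (r i)) : ℂ[X]).coeff (2 * j + 1) = -((d : ℂ) * (√n : ℝ)) := by
  obtain ⟨q, hq⟩ := h.exists_coeff_eq h1 (k := 2 * j + 1) (by omega)
  have hi := (isIntegral_coeff_prod_X_sub_C (h.isIntegral h1) (2 * j + 1)).pow 2
  have e : (∏ i, (X - C (r i))).coeff (2 * j + 1)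
      = ((q * n ^ (m - j - 1) : ℚ) : ℂ) * (√n : ℝ) := by
    rw [hq, hm, show 2 * m - (2 * j + 1) = 2 * (m - j - 1) + 1 by omega, pow_succ, pow_mul,
      sq_sqrt_eq]
    push_cast; ring
  have e2 : ((∏ i, (X - C (r i))).coeff (2 * j + 1)) ^ 2
      = (((q * n ^ (m - j - 1)) ^ 2 * n : ℚ) : ℂ) := by
    rw [e, mul_pow, sq_sqrt_eq]; push_cast; ring
  rw [e2] at hi
  obtain ⟨z, hz⟩ := exists_int_of_isIntegral_ratCast hi
  obtain ⟨y, hy⟩ := exists_int_of_sq_mul_squarefree hsq hz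
  exact ⟨-y, by rw [e, hy]; simp⟩

theorem exists_lucasPair (h : IsLucasRoots n r a) (h1 : 1 < n) (hsq : Squarefree n) :
    ∃ P Q : ℤ[X], IsLucasPair n P Q ∧
      ∀ w : ℂ, aeval (w ^ 2) P - (√n : ℝ) * w * aeval (w ^ 2) Q = ∏ i, (w - r i) := by
  obtain ⟨m, hm, hm0, -⟩ := h.exists_card h1 hsq
  set L : ℂ[X] := ∏ i, (X - C (r i)) with hL
  have hdeg : L.natDegree = 2 * m := by
    rw [hL, natDegree_finsetProd_X_sub_C_eq_card, Finset.card_univ, hm]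
  have hs0 : ((√n : ℝ) : ℂ) ≠ 0 := by
    rw [Complex.ofReal_ne_zero, Real.sqrt_ne_zero']; exact_mod_cast (by omega : 0 < n)
  choose! c hc using fun j (hj : j ≤ m) => h.exists_coeff_even h1 hm hj
  choose! d hd using fun j (hj : j < m) => h.exists_coeff_odd h1 hsq hm hj
  have hcm : c m = 1 := by
    have hmon : L.Monic := monic_prod_of_monic _ _ fun i _ => monic_X_sub_C _
    have := hc m le_rfl
    rw [← hL, ← hdeg, hmon.coeff_natDegree] at this
    exact_mod_cast this.symm
  -- The coefficient below the leading one is `-∑ r i = -√n`, since `a 1 = 1`.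
  have hdm : d (m - 1) = 1 := by
    have h2 := hd (m - 1) (by omega)
    have h3 := prod_X_sub_C_coeff_card_pred Finset.univ r (by rw [Finset.card_univ]; omega)
    have h4 := h.sum_pow 1 odd_one
    rw [Finset.card_univ, hm, show 2 * m - 1 = 2 * (m - 1) + 1 by omega, h2, neg_inj] at h3
    simp only [pow_one, h.one, Int.cast_one, one_mul] at h4
    rw [h4] at h3
    exact_mod_cast mul_right_cancel₀ hs0 (h3.trans (one_mul _).symm)
  set P : ℤ[X] := ∑ j ∈ Finset.range (m + 1), C (c j) * X ^ j with hP
  set Q : ℤ[X] := ∑ j ∈ Finset.range m, C (d j) * X ^ j with hQ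
  have hLw : ∀ w : ℂ, aeval (w ^ 2) P - (√n : ℝ) * w * aeval (w ^ 2) Q = ∏ i, (w - r i) := by
    intro w
    have hev : L.eval w = ∏ i, (w - r i) := by rw [hL, eval_prod]; simp
    rw [← hev, eval_eq_sum_range, hdeg, Finset.sum_range_succ, sum_range_two_mul, hP, hQ,
      Finset.sum_range_succ]
    simp only [map_add, map_sum, map_mul, map_pow, aeval_X, eq_intCast, map_intCast,
      Finset.mul_sum]
    rw [hc m le_rfl, add_sub_right_comm, sub_eq_add_neg, ← Finset.sum_neg_distrib]
    congr 1
    · congr 1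
      · exact Finset.sum_congr rfl fun j hj => by
          rw [hc j (Finset.mem_range.1 hj).le, pow_mul]
      · exact Finset.sum_congr rfl fun j hj => by
          rw [hd j (Finset.mem_range.1 hj)]; ring
    · rw [pow_mul]
  have hcoeff : ∀ (b : ℕ → ℤ) (N k : ℕ), k < N →
      (∑ j ∈ Finset.range N, C (b j) * X ^ j : ℤ[X]).coeff k = b k := by
    intro b N k hk
    simp [coeff_X_pow, hk]
  have hnat : ∀ (b : ℕ → ℤ) (N : ℕ),
      (∑ j ∈ Finset.range (N + 1), C (b j) * X ^ j : ℤ[X]).natDegree ≤ N := fun b N =>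
    natDegree_sum_le_of_forall_le _ _ fun j hj =>
      (natDegree_C_mul_X_pow_le _ _).trans (by have := Finset.mem_range.1 hj; omega)
  refine ⟨P, Q, ⟨?_, ?_, ?_⟩, hLw⟩
  · exact monic_of_natDegree_le_of_coeff_eq_one m (hnat c m) (by rw [hcoeff _ _ _ (by omega), hcm])
  · refine monic_of_natDegree_le_of_coeff_eq_one (m - 1) ?_
      (by rw [hcoeff _ _ _ (by omega), hdm])
    have := hnat d (m - 1)
    rwa [show m - 1 + 1 = m by omega] at this
  · apply map_injective (Int.castRingHom ℂ) Int.cast_injective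
    refine Polynomial.funext fun x => ?_
    obtain ⟨w, rfl⟩ := IsAlgClosed.exists_pow_nat_eq x two_pos
    have e1 := hLw w
    have e2 := hLw (-w)
    have e3 : ∏ i, (-w - r i) = ∏ i, (w + r i) := by
      have : ∀ i, -w - r i = -1 * (w + r i) := fun i => by ring
      simp_rw [this]
      rw [Finset.prod_mul_distrib, Finset.prod_const, Finset.card_univ, hm, pow_mul]
      simp
    rw [e3, neg_sq] at e2
    have e4 : (∏ i, (w - r i)) * ∏ i, (w + r i) = ∏ i, (w ^ 2 - r i ^ 2) := by
      rw [← Finset.prod_mul_distrib]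
      exact Finset.prod_congr rfl fun i _ => by ring
    have hev := h.eval_sq w
    rw [← e4, ← e1, ← e2] at hev
    simp only [← eval₂_eq_eval_map, ← algebraMap_int_eq, ← aeval_def]
    rw [hev]
    simp only [map_sub, map_mul, map_pow, aeval_X, map_natCast]
    linear_combination -(w ^ 2 * aeval (w ^ 2) Q ^ 2) * sq_sqrt_eq (n := n)

end IsLucasRoots

/-! ### Uniqueness of the pair, and the factors as products over the roots. -/

namespace IsLucasPair

variable {n : ℕ} {P Q P' Q' : ℤ[X]}

lemma natDegree_eq (h : IsLucasPair n P Q) (hn : n ≠ 0) (hF : (modCyclotomic n).Monic) :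
    (modCyclotomic n).natDegree = 2 * P.natDegree ∧ Q.natDegree < P.natDegree := by
  obtain ⟨hP, hQ, hPQ⟩ := h
  have hT : (n : ℤ[X]) * X * Q ^ 2 = C (n : ℤ) * (X * Q ^ 2) := by simp [mul_assoc]
  have hXQ : (X * Q ^ 2).Monic := monic_X.mul (hQ.pow 2)
  have hXQd : (X * Q ^ 2).natDegree = 2 * Q.natDegree + 1 := by
    rw [monic_X.natDegree_mul (hQ.pow 2), hQ.natDegree_pow, natDegree_X, add_comm]
  have hPd : (P ^ 2).natDegree = 2 * P.natDegree := hP.natDegree_pow 2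
  have hTd : (C (n : ℤ) * (X * Q ^ 2)).natDegree = 2 * Q.natDegree + 1 := by
    rw [natDegree_C_mul (by exact_mod_cast hn), hXQd]
  rw [hT] at hPQ
  -- Otherwise `F_n` would have leading coefficient `-n`.
  have hlt : Q.natDegree < P.natDegree := by
    by_contra hle
    have hd : (modCyclotomic n).natDegree = 2 * Q.natDegree + 1 := by
      rw [hPQ, natDegree_sub_eq_right_of_natDegree_lt (by omega), hTd]
    have h1 := hF.coeff_natDegree
    rw [hd, hPQ, coeff_sub, coeff_eq_zero_of_natDegree_lt (by omega), coeff_C_mul, ← hXQd,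
      hXQ.coeff_natDegree] at h1
    omega
  exact ⟨by rw [hPQ, natDegree_sub_eq_left_of_natDegree_lt (by omega), hPd], hlt⟩

lemma eq_of_monic_of_eq_neg {A B : ℤ[X]} (hA : A.Monic) (hB : B.Monic) : A ≠ -B := by
  intro h
  have := congrArg leadingCoeff h
  rw [leadingCoeff_neg, hA.leadingCoeff, hB.leadingCoeff] at this
  omega

/-- The irreducible `F_n` divides `(P Q')² - (P' Q)²`, hence one of `P Q' ± P' Q`. Both have smaller
degree, so that one vanishes; monicity rules out the plus sign. -/
theorem unique (h1 : 1 < n) (hsq : Squarefree n) (h : IsLucasPair n P Q)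
    (h' : IsLucasPair n P' Q') : P = P' ∧ Q = Q' := by
  obtain ⟨k, hk2, -, hk⟩ := exists_modCyclotomic_eq h1 hsq
  have hirr : Prime (modCyclotomic n) := by
    rw [hk]; exact (cyclotomic.irreducible (by omega)).prime
  have hmon : (modCyclotomic n).Monic := by rw [hk]; exact cyclotomic.monic k ℤ
  obtain ⟨hd, hlt⟩ := h.natDegree_eq (by omega) hmon
  obtain ⟨hd', hlt'⟩ := h'.natDegree_eq (by omega) hmon
  obtain ⟨hP, hQ, hPQ⟩ := h
  obtain ⟨hP', hQ', hPQ'⟩ := h'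
  have key : (P * Q' - P' * Q) * (P * Q' + P' * Q) = modCyclotomic n * (Q' ^ 2 - Q ^ 2) := by
    linear_combination -Q' ^ 2 * hPQ + Q ^ 2 * hPQ'
  have hm1 := hP.natDegree_mul hQ'
  have hm2 := hP'.natDegree_mul hQ
  have hcross : P * Q' = P' * Q := by
    rcases hirr.dvd_or_dvd ⟨_, key⟩ with hdvd | hdvd
    · have h3 := natDegree_sub_le (P * Q') (P' * Q)
      exact sub_eq_zero.1 (eq_zero_of_dvd_of_natDegree_lt hdvd (by omega))
    · have h3 := natDegree_add_le (P * Q') (P' * Q)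
      have h4 := eq_neg_of_add_eq_zero_left (eq_zero_of_dvd_of_natDegree_lt hdvd (by omega))
      exact (eq_of_monic_of_eq_neg (hP.mul hQ') (hP'.mul hQ) h4).elim
  rw [hcross, sub_self, zero_mul, eq_comm, mul_eq_zero, or_iff_right hirr.ne_zero, sub_eq_zero,
    sq_eq_sq_iff_eq_or_eq_neg] at key
  have hQQ := key.resolve_right (eq_of_monic_of_eq_neg hQ' hQ)
  rw [hQQ] at hcross
  exact ⟨mul_right_cancel₀ hQ.ne_zero hcross, hQQ.symm⟩

end IsLucasPair

theorem isLucasPair_lucas {n : ℕ} (h1 : 1 < n) (hsq : Squarefree n) :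
    IsLucasPair n (lucasC n) (lucasD n) := by
  obtain ⟨ι, _, r, a, hr⟩ := exists_isLucasRoots h1 hsq
  obtain ⟨P, Q, h, -⟩ := hr.exists_lucasPair h1 hsq
  have hex : ∃ p : ℤ[X] × ℤ[X], IsLucasPair n p.1 p.2 := ⟨(P, Q), h⟩
  rw [lucasC, lucasD, lucasPair, dif_pos hex]
  exact hex.choose_spec

lemma IsLucasRoots.factor_eq {n : ℕ} {ι : Type*} [Fintype ι] {r : ι → ℂ} {a : ℕ → ℤ}
    (hr : IsLucasRoots n r a) (h1 : 1 < n) (hsq : Squarefree n) {z : ℝ} (hz : 0 ≤ z) :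
    (factorPlus n (z ^ 2) : ℂ) = ∏ i, (z + r i) ∧ (factorMinus n (z ^ 2) : ℂ) = ∏ i, (z - r i) := by
  obtain ⟨P, Q, h, hL⟩ := hr.exists_lucasPair h1 hsq
  obtain ⟨rfl, rfl⟩ := h.unique h1 hsq (isLucasPair_lucas h1 hsq)
  have hcast : ∀ A : ℤ[X], ((aeval (z ^ 2) A : ℝ) : ℂ) = aeval ((z : ℂ) ^ 2) A := by
    intro A
    have := (aeval_algebraMap_apply ℂ (z ^ 2) A).symm
    simpa using this
  have hs : √((n : ℝ) * z ^ 2) = √n * z := by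
    rw [Real.sqrt_mul (Nat.cast_nonneg n), Real.sqrt_sq hz]
  constructor
  · have h2 := hL (-z)
    have h3 : ∏ i, (-(z : ℂ) - r i) = ∏ i, (z + r i) := by
      obtain ⟨m, hm, -⟩ := hr.exists_card h1 hsq
      have : ∀ i, -(z : ℂ) - r i = -1 * (z + r i) := fun i => by ring
      simp_rw [this]
      rw [Finset.prod_mul_distrib, Finset.prod_const, Finset.card_univ, hm, pow_mul]
      simp
    rw [← h3, ← h2, factorPlus, hs]
    push_cast
    rw [hcast, hcast, neg_sq]
    ring
  · rw [← hL z, factorMinus, hs]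
    push_cast
    rw [hcast, hcast]

/-! ### The asymptotic estimate. -/

lemma norm_log_one_add_sub_log_one_sub_le {u : ℂ} (hu : ‖u‖ ≤ 1 / 2) :
    ‖Complex.log (1 + u) - Complex.log (1 - u) - (2 * u + 2 / 3 * u ^ 3)‖ ≤ ‖u‖ ^ 4 := by
  have hT : ∀ v : ℂ, Complex.logTaylor (3 + 1) v = v - v ^ 2 / 2 + v ^ 3 / 3 := by
    intro v
    simp only [Complex.logTaylor_succ, Complex.logTaylor_zero]
    norm_num [Pi.add_apply]
    ring
  have hb : ∀ v : ℂ, ‖v‖ ≤ 1 / 2 →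
      ‖Complex.log (1 + v) - (v - v ^ 2 / 2 + v ^ 3 / 3)‖ ≤ ‖v‖ ^ 4 / 2 := by
    intro v hv
    have h := Complex.norm_log_sub_logTaylor_le 3 (z := v) (by linarith)
    rw [hT] at h
    refine h.trans ?_
    have h2 : (1 - ‖v‖)⁻¹ ≤ 2 := by
      rw [inv_le_comm₀ (by linarith) two_pos]; linarith
    have h4 : 0 ≤ ‖v‖ ^ 4 := by positivity
    norm_num
    nlinarith
  have h1 := hb u hu
  have h2 := hb (-u) (by rwa [norm_neg])
  rw [norm_neg] at h2
  have e : Complex.log (1 + u) - Complex.log (1 - u) - (2 * u + 2 / 3 * u ^ 3)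
      = (Complex.log (1 + u) - (u - u ^ 2 / 2 + u ^ 3 / 3))
        - (Complex.log (1 + -u) - (-u - (-u) ^ 2 / 2 + (-u) ^ 3 / 3)) := by
    rw [← sub_eq_add_neg]; ring
  rw [e]
  exact (norm_sub_le _ _).trans (by linarith)

lemma prod_div_prod_eq_exp {ι : Type*} [Fintype ι] {r : ι → ℂ} {z : ℂ} (hz : z ≠ 0)
    (hr : ∀ i, ‖r i / z‖ < 1) :
    (∏ i, (z + r i)) / ∏ i, (z - r i)
      = Complex.exp (∑ i, (Complex.log (1 + r i / z) - Complex.log (1 - r i / z))) := by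
  rw [Complex.exp_sum, ← Finset.prod_div_distrib]
  refine Finset.prod_congr rfl fun i _ => ?_
  have h1 : 1 + r i / z ≠ 0 :=
    Complex.slitPlane_ne_zero (Complex.mem_slitPlane_of_norm_lt_one (hr i))
  have h2 : 1 - r i / z ≠ 0 := by
    rw [sub_eq_add_neg]
    exact Complex.slitPlane_ne_zero (Complex.mem_slitPlane_of_norm_lt_one (by
      rw [norm_neg]; exact hr i))
  rw [Complex.exp_sub, Complex.exp_log h1, Complex.exp_log h2]
  rw [eq_comm, ← mul_div_mul_left _ _ hz]
  congr 1 <;> field_simp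

/-- The cubic term must be kept: bounding up to `2n` terms of size `|u|³` separately would give only
`O(n ^ (-1/2))`. `hmn` ensures `|u| ≤ 1/2`, and `hK` puts the exponent within 1 of `2 / m`. -/
lemma IsLucasRoots.norm_prod_div_prod_sub_exp_le {n : ℕ} {ι : Type*} [Fintype ι] {r : ι → ℂ}
    {a : ℕ → ℤ} (hr : IsLucasRoots n r a) (h1 : 1 < n) (hsq : Squarefree n) {m : ℝ} (hm : 0 < m)
    (hmn : 4 ≤ m ^ 2 * n) (hK : 1 / m ^ 3 + 2 / m ^ 4 < n) :
    ‖(∏ i, (((m * √n : ℝ) : ℂ) + r i)) / ∏ i, (((m * √n : ℝ) : ℂ) - r i)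
      - Complex.exp ((2 / m : ℝ) : ℂ)‖
      ≤ 2 * Real.exp (2 / m) * (1 / m ^ 3 + 2 / m ^ 4) * (1 / n) := by
  have hn : (0 : ℝ) < n := by exact_mod_cast (by omega : 0 < n)
  have hs : 0 < √(n : ℝ) := Real.sqrt_pos.2 hn
  have hss : √(n : ℝ) ^ 2 = n := Real.sq_sqrt hn.le
  set K := 1 / m ^ 3 + 2 / m ^ 4 with hKdef
  set z : ℝ := m * √n with hz
  have hz0 : 0 < z := mul_pos hm hs
  have hz2 : 2 ≤ z := by
    have : (2 : ℝ) ^ 2 ≤ z ^ 2 := by rw [hz, mul_pow, hss]; linarith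
    exact (pow_le_pow_iff_left₀ two_pos.le hz0.le two_ne_zero).1 this
  have hzc : (z : ℂ) ≠ 0 := by exact_mod_cast hz0.ne'
  have hnorm : ∀ i, ‖r i / z‖ = 1 / z := fun i => by
    rw [norm_div, Complex.norm_eq_one_of_pow_eq_one (hr.pow_eq_one i) (by omega), Complex.norm_real,
      Real.norm_of_nonneg hz0.le]
  have hhalf : 1 / z ≤ 1 / 2 := one_div_le_one_div_of_le two_pos hz2
  rw [prod_div_prod_eq_exp hzc (fun i => by rw [hnorm]; linarith)]
  set E := ∑ i, (Complex.log (1 + r i / z) - Complex.log (1 - r i / z)) with hE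
  have hmain : ∑ i, (2 * (r i / z) + 2 / 3 * (r i / z) ^ 3)
      = ((2 / m : ℝ) : ℂ) + 2 / 3 * (a 3 * (√n : ℝ) / (z : ℂ) ^ 3) := by
    have e1 := hr.sum_pow 1 odd_one
    have e3 := hr.sum_pow 3 (by decide)
    simp only [pow_one, hr.one, Int.cast_one, one_mul] at e1
    simp only [div_pow]
    rw [Finset.sum_add_distrib, ← Finset.mul_sum, ← Finset.mul_sum, ← Finset.sum_div,
      ← Finset.sum_div, e1, e3, hz]
    have hsc : ((√n : ℝ) : ℂ) ≠ 0 := by exact_mod_cast hs.ne'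
    have hmc : (m : ℂ) ≠ 0 := by exact_mod_cast hm.ne'
    push_cast
    congr 1
    field_simp
  have herr : ‖E - ∑ i, (2 * (r i / z) + 2 / 3 * (r i / z) ^ 3)‖ ≤ 2 / m ^ 4 * (1 / n) := by
    rw [hE, ← Finset.sum_sub_distrib]
    refine (norm_sum_le _ _).trans ?_
    have : ∀ i ∈ Finset.univ, ‖Complex.log (1 + r i / z) - Complex.log (1 - r i / z)
        - (2 * (r i / z) + 2 / 3 * (r i / z) ^ 3)‖ ≤ (1 / z) ^ 4 := fun i _ => by
      have h := norm_log_one_add_sub_log_one_sub_le (u := r i / z) (by rw [hnorm]; exact hhalf)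
      rwa [hnorm] at h
    refine (Finset.sum_le_card_nsmul _ _ _ this).trans ?_
    obtain ⟨k, hk, -, hkn⟩ := hr.exists_card h1 hsq
    have hcard : (Fintype.card ι : ℝ) ≤ 2 * n := by
      exact_mod_cast (by omega : Fintype.card ι ≤ 2 * n)
    have hz4 : z ^ 4 = m ^ 4 * n ^ 2 := by
      rw [hz, mul_pow, show √(n : ℝ) ^ 4 = (√(n : ℝ) ^ 2) ^ 2 by ring, hss]
    rw [Finset.card_univ, nsmul_eq_mul, one_div, inv_pow, hz4]
    calc (Fintype.card ι : ℝ) * (m ^ 4 * n ^ 2)⁻¹ ≤ 2 * n * (m ^ 4 * n ^ 2)⁻¹ := by gcongr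
      _ = 2 / m ^ 4 * (1 / n) := by field_simp
  have hcubic : ‖(2 / 3 * (a 3 * (√n : ℝ) / (z : ℂ) ^ 3) : ℂ)‖ ≤ 1 / m ^ 3 * (1 / n) := by
    have ha : |(a 3 : ℝ)| ≤ 1 := by exact_mod_cast hr.abs_le_one 3
    have hz3 : z ^ 3 = m ^ 3 * n * √n := by
      rw [hz, mul_pow, show √(n : ℝ) ^ 3 = √(n : ℝ) ^ 2 * √n by ring, hss]; ring
    have e : (2 / 3 * (a 3 * (√n : ℝ) / (z : ℂ) ^ 3) : ℂ)
        = ((2 / 3 * (a 3 * √n / z ^ 3) : ℝ) : ℂ) := by push_cast; rfl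
    have e2 : 2 / 3 * ((a 3 : ℝ) * √n / z ^ 3) = a 3 * (2 / 3 * (1 / m ^ 3 * (1 / n))) := by
      rw [hz3]; field_simp
    rw [e, Complex.norm_real, e2, Real.norm_eq_abs, abs_mul,
      abs_of_nonneg (a := 2 / 3 * (1 / m ^ 3 * (1 / (n : ℝ)))) (by positivity)]
    have hp : 0 ≤ 1 / m ^ 3 * (1 / (n : ℝ)) := by positivity
    nlinarith
  have hdist : ‖E - ((2 / m : ℝ) : ℂ)‖ ≤ K * (1 / n) := by
    have : E - ((2 / m : ℝ) : ℂ) = (E - ∑ i, (2 * (r i / z) + 2 / 3 * (r i / z) ^ 3))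
        + 2 / 3 * (a 3 * (√n : ℝ) / (z : ℂ) ^ 3) := by rw [hmain]; ring
    rw [this]
    refine (norm_add_le _ _).trans ?_
    rw [hKdef, add_mul]
    linarith
  have hlt : ‖E - ((2 / m : ℝ) : ℂ)‖ < 1 := by
    refine hdist.trans_lt ?_
    rwa [mul_one_div, div_lt_one hn]
  -- On the unit ball about `2 / m`, the local Lipschitz bound for `exp` has constant `(1 + 1) * exp
  -- (2 / m)`.
  refine (Complex.locally_lipschitz_exp zero_le_one le_rfl _ _ hlt).trans ?_
  rw [Complex.norm_exp, Complex.ofReal_re, one_add_one_eq_two, mul_assoc (2 * Real.exp (2 / m))]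
  gcongr

end Aurifeuille

theorem corollary1 (m : ℚ) (hm : 0 < m) :
    (∀ n : ℕ, 1 < n → Squarefree n →
      Aurifeuille.IsLucasPair n (Aurifeuille.lucasC n) (Aurifeuille.lucasD n)) ∧
    (fun n : ℕ =>
        Aurifeuille.factorPlus n ((m : ℝ) ^ 2 * (n : ℝ)) /
          Aurifeuille.factorMinus n ((m : ℝ) ^ 2 * (n : ℝ)) - Real.exp (2 / (m : ℝ)))
      =O[atTop ⊓ 𝓟 {n : ℕ | 1 < n ∧ Squarefree n}] (fun n : ℕ => 1 / (n : ℝ)) := by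
  -- The first conjunct shows that the default value `(0, 0)` of `lucasPair` never occurs for these
  -- `n`.
  refine ⟨fun n h1 hsq => Aurifeuille.isLucasPair_lucas h1 hsq, ?_⟩
  have hm' : (0 : ℝ) < m := by exact_mod_cast hm
  refine IsBigO.of_bound (2 * Real.exp (2 / m) * (1 / (m : ℝ) ^ 3 + 2 / (m : ℝ) ^ 4)) ?_
  rw [eventually_inf_principal]
  filter_upwards [tendsto_natCast_atTop_atTop.eventually_ge_atTop (4 / (m : ℝ) ^ 2),
    tendsto_natCast_atTop_atTop.eventually_gt_atTop (1 / (m : ℝ) ^ 3 + 2 / (m : ℝ) ^ 4)]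
    with n hn1 hn2 ⟨h1, hsq⟩
  rw [div_le_iff₀' (by positivity)] at hn1
  obtain ⟨ι, _, r, a, hr⟩ := Aurifeuille.exists_isLucasRoots h1 hsq
  have hx : (m : ℝ) ^ 2 * n = (m * √n) ^ 2 := by
    rw [mul_pow, Real.sq_sqrt (Nat.cast_nonneg n)]
  have key := hr.norm_prod_div_prod_sub_exp_le h1 hsq hm' hn1 hn2
  obtain ⟨e1, e2⟩ := hr.factor_eq h1 hsq (z := m * √n) (by positivity)
  rw [← e1, ← e2, ← Complex.ofReal_exp, ← Complex.ofReal_div, ← Complex.ofReal_sub,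
    Complex.norm_real, ← hx] at key
  rwa [Real.norm_of_nonneg (by positivity : (0 : ℝ) ≤ 1 / n)]
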